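/- Let $d\ge 2$ and let $K\subset\mathbf R^d$ be a compact convex domain (with non-empty interior) whose boundary $S=\partial K$ is a smooth ($C^\infty$) hypersurface with positive principal curvatures everywhere. Let $G:S\to\mathbf S^{d-1}$, $G(x)=$ outer unit normal of $S$ at $x$, be the Gauss map, and let $h(n)=\sup_{x\in K}\langle x,n\rangle$ be the support function of $K$. Every oriented line in $\mathbf R^d$ is written uniquely as $\{m+tn : t\in\mathbf R\}$ with $|n|=1$ and $m\perp n$, and is identified with $(m,n)\in T^*\mathbf S^{d-1}$, where $m$ stands for the covector $\xi\mapsto\langle m,\xi\rangle$ on $T_n\mathbf S^{d-1}=n^{\perp}$. Let $\Omega$ be the set of oriented lines that intersect $S$. The billiard ball map $T$ sends $(m,n)\in\Omega$ to the oriented line through $P$ with direction $n-2\langle n,G(P)\rangle G(P)$, where $P$ is the last point of the line in $K$. Then $G$ is a bijection of $S$ onto $\mathbf S^{d-1}$, $h(n)=\langle G^{-1}(n),n\rangle$ for $n\in\mathbf S^{d-1}$, and the function $\mathrm S$ on $(\mathbf S^{d-1}\times\mathbf S^{d-1})\setminus\Delta$ ($\Delta$ the diagonal) given by $$\mathrm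 S(n_1,n_2)=h\!\left(\frac{n_1-n_2}{|n_1-n_2|}\right)|n_1-n_2|=\left\langle G^{-1}\!\left(\frac{n_1-n_2}{|n_1-n_2|}\right),\,n_1-n_2\right\rangle$$ is $C^\infty$ and has the following properties. Denote by $D_1\mathrm S(n_1,n_2)\in T^*_{n_1}\mathbf S^{d-1}$ and $D_2\mathrm S(n_1,n_2)\in T^*_{n_2}\mathbf S^{d-1}$ its differentials in the first and in the second variable. 1. (Generating function.) $T$ changes the direction of every oriented line that meets the interior of $K$. For all $(m_1,n_1),(m_2,n_2)\in T^*\mathbf S^{d-1}$ with $n_1\neq n_2$, $$(m_1,n_1)\in\Omega\ \text{ and }\ T(m_1,n_1)=(m_2,n_2)\iff m_1=D_1\mathrm S(n_1,n_2)\ \text{ and }\ m_2=-D_2\mathrm S(n_1,n_2).$$ 2. (Twist condition.) For all $n_1\ne n_2$ in $\mathbf S^{d-1}$ the mixed second differentials $$D_{12}=D_1\circ D_2:T_{n_1}\mathbf S^{d-1}\to T^*_{n_2}\mathbf S^{d-1},\qquad D_{21}=D_2\circ D_1:T_{n_2}\mathbf S^{d-1}\to T^*_{n_1}\mathbf S^{d-1},$$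 that is, the differential at $n_1$ of $n\mapsto D_2\mathrm S(n,n_2)$ and the differential at $n_2$ of $n\mapsto D_1\mathrm S(n_1,n)$, are isomorphisms. -/

import Mathlib

open Metric Module
open scoped Manifold ContDiff

noncomputable section

/-- On the open set `U`, the body `K` is the sublevel set `{f ≤ 0}` of a smooth function `f`
without critical points; hence the boundary of `K` in `U` is the smooth hypersurface `{f = 0}`. -/
structure IsLocalDefiningFunction {k : ℕ} (K U : Set (EuclideanSpace ℝ (Fin (k + 1))))
    (f : EuclideanSpace ℝ (Fin (k + 1)) → ℝ) : Prop where
  isOpen : IsOpen U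
  smooth : ContDiffOn ℝ ∞ f U
  regular : ∀ y ∈ U, fderiv ℝ f y ≠ 0
  mem_iff : ∀ y ∈ U, (y ∈ K ↔ f y ≤ 0)

/-- `κ` is a principal curvature of the boundary of `K` at the boundary point `x` (with the sign
for which the unit sphere has curvature `1`): an eigenvalue of the second fundamental form
`(v, w) ↦ D²f(x)(v, w) / ‖Df(x)‖` on the tangent space `ker Df(x)`. -/
def IsPrincipalCurvature {k : ℕ} (K : Set (EuclideanSpace ℝ (Fin (k + 1))))
    (x : EuclideanSpace ℝ (Fin (k + 1))) (κ : ℝ) : Prop :=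
  x ∈ frontier K ∧
  ∃ (U : Set (EuclideanSpace ℝ (Fin (k + 1)))) (f : EuclideanSpace ℝ (Fin (k + 1)) → ℝ),
    IsLocalDefiningFunction K U f ∧ x ∈ U ∧
    ∃ v : EuclideanSpace ℝ (Fin (k + 1)), v ≠ 0 ∧ fderiv ℝ f x v = 0 ∧
      ∀ w, fderiv ℝ f x w = 0 →
        fderiv ℝ (fderiv ℝ f) x v w / ‖fderiv ℝ f x‖ = κ * inner ℝ v w

/-- A compact convex domain bounded by a smooth hypersurface `frontier K` all of whose principal
curvatures are positive. -/
structure IsBilliardTable {k : ℕ} (K : Set (EuclideanSpace ℝ (Fin (k + 1)))) : Prop where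
  convex : Convex ℝ K
  compact : IsCompact K
  interior_nonempty : (interior K).Nonempty
  smooth_boundary : ∀ x ∈ frontier K, ∃ U f, IsLocalDefiningFunction K U f ∧ x ∈ U
  curvature_pos : ∀ x κ, IsPrincipalCurvature K x κ → 0 < κ

/-- `ν` is the outer unit normal to the boundary of `K` at `x`: the normalized gradient of a local
defining function. -/
def IsOuterUnitNormal {k : ℕ} (K : Set (EuclideanSpace ℝ (Fin (k + 1))))
    (x ν : EuclideanSpace ℝ (Fin (k + 1))) : Prop :=
  x ∈ frontier K ∧
  ∃ (U : Set (EuclideanSpace ℝ (Fin (k + 1)))) (f : EuclideanSpace ℝ (Fin (k + 1)) → ℝ),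
    IsLocalDefiningFunction K U f ∧ x ∈ U ∧ ν = ‖gradient f x‖⁻¹ • gradient f x

/-- The Gauss map `x ↦ n(x)` of the boundary of `K`. Only its values on `frontier K` matter. -/
def gaussMap {k : ℕ} (K : Set (EuclideanSpace ℝ (Fin (k + 1))))
    (x : EuclideanSpace ℝ (Fin (k + 1))) : EuclideanSpace ℝ (Fin (k + 1)) :=
  Classical.epsilon (fun ν => IsOuterUnitNormal K x ν)

/-- The inverse of the Gauss map: the boundary point with the given outer unit normal. -/
def gaussInv {k : ℕ} (K : Set (EuclideanSpace ℝ (Fin (k + 1)))) :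
    EuclideanSpace ℝ (Fin (k + 1)) → EuclideanSpace ℝ (Fin (k + 1)) :=
  Function.invFunOn (gaussMap K) (frontier K)

/-- The support function `h(n) = sup {⟨x, n⟩ : x ∈ K}`. -/
def supportFun {k : ℕ} (K : Set (EuclideanSpace ℝ (Fin (k + 1))))
    (n : EuclideanSpace ℝ (Fin (k + 1))) : ℝ :=
  sSup ((fun x => inner ℝ x n) '' K)

/-- An oriented line `{m + t n}` with `‖n‖ = 1` and `m ⟂ n`: `dir` is `n`, `foot` is `m`.
These are the points of `T^*S^k`, `m` being a (co)tangent vector of the sphere at `n`. -/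
@[ext]
structure OrientedLine (k : ℕ) where
  dir : sphere (0 : EuclideanSpace ℝ (Fin (k + 1))) 1
  foot : EuclideanSpace ℝ (Fin (k + 1))
  foot_perp_dir : inner ℝ foot (dir : EuclideanSpace ℝ (Fin (k + 1))) = 0

namespace OrientedLine

/-- The point `m + t n` of the line. -/
def point {k : ℕ} (l : OrientedLine k) (t : ℝ) : EuclideanSpace ℝ (Fin (k + 1)) :=
  l.foot + t • (l.dir : EuclideanSpace ℝ (Fin (k + 1)))

/-- The line through the point `P` in the direction `n`. -/
def through {k : ℕ} (P : EuclideanSpace ℝ (Fin (k + 1)))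
    (n : sphere (0 : EuclideanSpace ℝ (Fin (k + 1))) 1) : OrientedLine k where
  dir := n
  foot := P - inner ℝ P (n : EuclideanSpace ℝ (Fin (k + 1))) •
    (n : EuclideanSpace ℝ (Fin (k + 1)))
  foot_perp_dir := by
    have h : ‖(n : EuclideanSpace ℝ (Fin (k + 1)))‖ = 1 := by simp
    rw [inner_sub_left, real_inner_smul_left, real_inner_self_eq_norm_sq, h]
    ring

/-- The covector `ξ ↦ ⟨m, ξ⟩` on the tangent space of the sphere at `n`; an abstract tangent vector
is turned into a vector of the ambient space by the differential of the inclusion. -/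
def covector {k : ℕ} (l : OrientedLine k) : TangentSpace (𝓡 k) l.dir →L[ℝ] ℝ :=
  (innerSL ℝ l.foot).comp
    (mfderiv (𝓡 k) 𝓘(ℝ, EuclideanSpace ℝ (Fin (k + 1)))
      (fun n : sphere (0 : EuclideanSpace ℝ (Fin (k + 1))) 1 =>
        (n : EuclideanSpace ℝ (Fin (k + 1)))) l.dir)

end OrientedLine

/-- The phase space: the oriented lines that intersect the boundary of `K`. -/
def phaseSpace {k : ℕ} (K : Set (EuclideanSpace ℝ (Fin (k + 1)))) : Set (OrientedLine k) :=
  {l | ∃ t : ℝ, l.point t ∈ frontier K}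

/-- The last point of the line `l` in `K`. -/
def exitPoint {k : ℕ} (K : Set (EuclideanSpace ℝ (Fin (k + 1)))) (l : OrientedLine k) :
    EuclideanSpace ℝ (Fin (k + 1)) :=
  l.point (sSup {t : ℝ | l.point t ∈ K})

/-- The direction of `l` after the elastic reflection at its exit point, that is, its mirror image
in the tangent hyperplane of the boundary there. -/
def reflectedDir {k : ℕ} (K : Set (EuclideanSpace ℝ (Fin (k + 1)))) (l : OrientedLine k) :
    sphere (0 : EuclideanSpace ℝ (Fin (k + 1))) 1 :=
  ⟨(Submodule.span ℝ {gaussMap K (exitPoint K l)})ᗮ.reflection l.dir, by simp⟩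

/-- The billiard ball map: the line `l` goes to the line through its exit point in the reflected
direction. It is meaningful on `phaseSpace K`; a line tangent to the boundary stays fixed. -/
def billiardMap {k : ℕ} (K : Set (EuclideanSpace ℝ (Fin (k + 1)))) (l : OrientedLine k) :
    OrientedLine k :=
  OrientedLine.through (exitPoint K l) (reflectedDir K l)

/-- The unit vector `(n₁ - n₂) / |n₁ - n₂|`, for `n₁ ≠ n₂`. -/
def chordDir {k : ℕ} (n₁ n₂ : sphere (0 : EuclideanSpace ℝ (Fin (k + 1))) 1) :
    EuclideanSpace ℝ (Fin (k + 1)) :=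
  ‖(n₁ : EuclideanSpace ℝ (Fin (k + 1))) - n₂‖⁻¹ • ((n₁ : EuclideanSpace ℝ (Fin (k + 1))) - n₂)

/-- The generating function `S(n₁, n₂) = h((n₁ - n₂) / |n₁ - n₂|) |n₁ - n₂|`, for `n₁ ≠ n₂`. -/
def genFun {k : ℕ} (K : Set (EuclideanSpace ℝ (Fin (k + 1))))
    (n₁ n₂ : sphere (0 : EuclideanSpace ℝ (Fin (k + 1))) 1) : ℝ :=
  supportFun K (chordDir n₁ n₂) * ‖(n₁ : EuclideanSpace ℝ (Fin (k + 1))) - n₂‖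

/-- `D₁ S`, the differential of `S` in its first variable. -/
def genD1 {k : ℕ} (K : Set (EuclideanSpace ℝ (Fin (k + 1))))
    (n₁ n₂ : sphere (0 : EuclideanSpace ℝ (Fin (k + 1))) 1) :
    TangentSpace (𝓡 k) n₁ →L[ℝ] ℝ :=
  mfderiv (𝓡 k) 𝓘(ℝ, ℝ) (fun n => genFun K n n₂) n₁

/-- `D₂ S`, the differential of `S` in its second variable. -/
def genD2 {k : ℕ} (K : Set (EuclideanSpace ℝ (Fin (k + 1))))
    (n₁ n₂ : sphere (0 : EuclideanSpace ℝ (Fin (k + 1))) 1) :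
    TangentSpace (𝓡 k) n₂ →L[ℝ] ℝ :=
  mfderiv (𝓡 k) 𝓘(ℝ, ℝ) (fun n => genFun K n₁ n) n₂

/-- `D₁₂ = D₁ ∘ D₂`: the differential at `n₁` of the map `n ↦ D₂ S(n, n₂)` into the (fixed)
cotangent space at `n₂`. -/
def genD12 {k : ℕ} (K : Set (EuclideanSpace ℝ (Fin (k + 1))))
    (n₁ n₂ : sphere (0 : EuclideanSpace ℝ (Fin (k + 1))) 1) :
    TangentSpace (𝓡 k) n₁ →L[ℝ] (TangentSpace (𝓡 k) n₂ →L[ℝ] ℝ) :=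
  mfderiv (𝓡 k) 𝓘(ℝ, EuclideanSpace ℝ (Fin k) →L[ℝ] ℝ)
    (M' := EuclideanSpace ℝ (Fin k) →L[ℝ] ℝ) (fun n => genD2 K n n₂) n₁

/-- `D₂₁ = D₂ ∘ D₁`: the differential at `n₂` of the map `n ↦ D₁ S(n₁, n)` into the (fixed)
cotangent space at `n₁`. -/
def genD21 {k : ℕ} (K : Set (EuclideanSpace ℝ (Fin (k + 1))))
    (n₁ n₂ : sphere (0 : EuclideanSpace ℝ (Fin (k + 1))) 1) :
    TangentSpace (𝓡 k) n₂ →L[ℝ] (TangentSpace (𝓡 k) n₁ →L[ℝ] ℝ) :=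
  mfderiv (𝓡 k) 𝓘(ℝ, EuclideanSpace ℝ (Fin k) →L[ℝ] ℝ)
    (M' := EuclideanSpace ℝ (Fin k) →L[ℝ] ℝ) (fun n => genD1 K n₁ n) n₂

end

/-! Extend the support function to H(v) = |v| h(v/|v|) for v ≠ 0, so that S(n₁, n₂) = H(n₁ - n₂),
and let P(v) be the boundary point with outer normal v/|v|. Everything rests on three facts about P.

P is smooth: it comes from inverting (x, s) ↦ (s∇f(x), f(x)) for a local defining function f, a map
whose differential is invertible because the second fundamental form is positive definite
(`contDiffAt_supportPoint`).

The gradient of H at v is P(v), by an envelope argument (`hasFDerivAt_homogeneousSupportFun`). Hence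
D₁S and -D₂S are ⟨P(n₁ - n₂), ·⟩ restricted to the tangent spaces at n₁ and n₂. A line whose
covector is such a restriction passes through P(n₁ - n₂), where the normal is parallel to n₁ - n₂:
this is the reflection law (`billiardMap_eq_iff`).

The differential of P at v has image in the orthogonal complement of v and kernel in ℝv. For v = n₁
- n₂, which is orthogonal to neither n₁ nor n₂, this makes (ξ, η) ↦ -⟨dP ξ, η⟩ nondegenerate on the
two tangent spaces, which is the twist condition (`eq_zero_of_forall_inner_fderiv_eq_zero`). -/

/-! ### Half-spaces and positive definite forms -/

section LinearAlgebra

variable {E : Type*} [NormedAddCommGroup E] [InnerProductSpace ℝ E]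

/-- A unit vector is determined by the half-space it defines. -/
theorem eq_of_halfSpace_subset {a b : E} (ha : ‖a‖ = 1) (hb : ‖b‖ = 1)
    (h : ∀ w, inner ℝ a w < 0 → inner ℝ b w ≤ 0) : a = b := by
  by_contra hne
  have h1 : inner ℝ a b < 1 := by
    refine lt_of_le_of_ne ?_ fun h1 => hne ((inner_eq_one_iff_of_norm_eq_one ha hb).1 h1)
    simpa [ha, hb] using real_inner_le_norm a b
  -- For distinct unit vectors, b - a has negative product with a and positive product with b.
  have h2 := h (b - a) (by
    rw [inner_sub_right, real_inner_self_eq_norm_sq, ha]; linarith)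
  rw [inner_sub_right, real_inner_self_eq_norm_sq, hb, real_inner_comm] at h2
  linarith

/-- A symmetric bilinear form on a finite-dimensional subspace is positive definite when all its
eigenvalues are positive. -/
theorem bilin_pos_of_eigenvalues_pos (W : Submodule ℝ E) [FiniteDimensional ℝ W]
    (B : E →L[ℝ] E →L[ℝ] ℝ) (hB : ∀ v w, B v w = B w v)
    (hpos : ∀ κ : ℝ, ∀ v ∈ W, v ≠ 0 → (∀ w ∈ W, B v w = κ * inner ℝ v w) → 0 < κ)
    {v : E} (hv : v ∈ W) (hv0 : v ≠ 0) : 0 < B v v := by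
  -- The self-adjoint operator representing B on W; its eigenbasis diagonalizes B.
  let T : W →ₗ[ℝ] W :=
    { toFun := fun w => (InnerProductSpace.toDual ℝ W).symm ((B w).comp W.subtypeL)
      map_add' := fun a b => by simp [ContinuousLinearMap.add_comp]
      map_smul' := fun c a => by simp [ContinuousLinearMap.smul_comp] }
  have hT : ∀ a b : W, inner ℝ (T a) b = B a b := fun a b => by
    simp [T]
  have hsymm : T.IsSymmetric := fun a b => by
    rw [hT, real_inner_comm, hT, hB]
  let b := hsymm.eigenvectorBasis rfl
  let ev := hsymm.eigenvalues rfl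
  have hTb : ∀ i, T (b i) = ev i • b i := fun i => hsymm.apply_eigenvectorBasis rfl i
  have hev : ∀ i, 0 < ev i := fun i => by
    refine hpos (ev i) (b i) (b i).2 ?_ ?_
    · simpa using (b.orthonormal.ne_zero i)
    · intro w hw
      have := hT (b i) ⟨w, hw⟩
      rw [hTb, real_inner_smul_left] at this
      simpa using this.symm
  have hsum : B v v = ∑ i, ev i * (inner ℝ (b i) (⟨v, hv⟩ : W)) ^ 2 := by
    rw [← hT ⟨v, hv⟩ ⟨v, hv⟩, ← b.sum_inner_mul_inner]
    refine Finset.sum_congr rfl fun i _ => ?_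
    rw [hsymm ⟨v, hv⟩ (b i), hTb, real_inner_smul_right, real_inner_comm]
    ring
  rw [hsum]
  refine Finset.sum_pos' (fun i _ => mul_nonneg (hev i).le (sq_nonneg _)) ?_
  by_contra! hcon
  have hz : ∀ i, inner ℝ (b i) (⟨v, hv⟩ : W) = 0 := fun i => by
    by_contra hne
    exact absurd (hcon i (Finset.mem_univ i)) (not_le.2 (mul_pos (hev i) (by positivity)))
  have : (⟨v, hv⟩ : W) = 0 := by
    rw [← b.sum_repr' ⟨v, hv⟩]
    simp [hz]
  exact hv0 (by simpa using congrArg Subtype.val this)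

end LinearAlgebra

/-! ### Supporting half-spaces and bijectivity of the Gauss map -/

section Boundary

variable {k : ℕ} {K U : Set (EuclideanSpace ℝ (Fin (k + 1)))}
  {f : EuclideanSpace ℝ (Fin (k + 1)) → ℝ}
  {x y ν ν' : EuclideanSpace ℝ (Fin (k + 1))}

theorem inner_gradient (f : EuclideanSpace ℝ (Fin (k + 1)) → ℝ)
    (x w : EuclideanSpace ℝ (Fin (k + 1))) : inner ℝ (gradient f x) w = fderiv ℝ f x w := by
  simp [gradient]

namespace IsLocalDefiningFunction

theorem contDiffAt (h : IsLocalDefiningFunction K U f) (hx : x ∈ U) : ContDiffAt ℝ ∞ f x :=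
  h.smooth.contDiffAt (h.isOpen.mem_nhds hx)

theorem hasFDerivAt (h : IsLocalDefiningFunction K U f) (hx : x ∈ U) :
    HasFDerivAt f (fderiv ℝ f x) x :=
  ((h.contDiffAt hx).differentiableAt (by simp)).hasFDerivAt

theorem contDiffAt_fderiv (h : IsLocalDefiningFunction K U f) (hx : x ∈ U) :
    ContDiffAt ℝ ∞ (fderiv ℝ f) x :=
  (h.contDiffAt hx).fderiv_right (by simp)

theorem hasFDerivAt_fderiv (h : IsLocalDefiningFunction K U f) (hx : x ∈ U) :
    HasFDerivAt (fderiv ℝ f) (fderiv ℝ (fderiv ℝ f) x) x :=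
  ((h.contDiffAt_fderiv hx).differentiableAt (by simp)).hasFDerivAt

theorem fderiv_fderiv_symm (h : IsLocalDefiningFunction K U f) (hx : x ∈ U)
    (v w : EuclideanSpace ℝ (Fin (k + 1))) :
    fderiv ℝ (fderiv ℝ f) x v w = fderiv ℝ (fderiv ℝ f) x w v :=
  (h.contDiffAt hx).isSymmSndFDerivAt
    (by rw [minSmoothness_of_isRCLikeNormedField]; exact WithTop.coe_le_coe.2 le_top) v w

theorem gradient_ne_zero (h : IsLocalDefiningFunction K U f) (hx : x ∈ U) : gradient f x ≠ 0 := by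
  simpa [gradient] using h.regular x hx

theorem norm_gradient_pos (h : IsLocalDefiningFunction K U f) (hx : x ∈ U) :
    0 < ‖gradient f x‖ := norm_pos_iff.2 (h.gradient_ne_zero hx)

theorem norm_normal (h : IsLocalDefiningFunction K U f) (hx : x ∈ U) :
    ‖‖gradient f x‖⁻¹ • gradient f x‖ = 1 :=
  norm_smul_inv_norm (h.gradient_ne_zero hx)

/-- Vectors with negative slope point into the body. -/
theorem eventually_add_smul_mem (h : IsLocalDefiningFunction K U f) (hx : x ∈ U) (hfx : f x ≤ 0)
    {w : EuclideanSpace ℝ (Fin (k + 1))} (hw : fderiv ℝ f x w < 0) :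
    ∀ᶠ t : ℝ in nhdsWithin 0 (Set.Ioi 0), x + t • w ∈ K := by
  have hline : HasDerivAt (fun t : ℝ => x + t • w) w 0 := by
    simpa using ((hasDerivAt_id (0 : ℝ)).smul_const w).const_add x
  have hd : HasDerivAt (fun t : ℝ => f (x + t • w)) (fderiv ℝ f x w) 0 := by
    have h0 := h.hasFDerivAt hx
    have h1 : HasFDerivAt f (fderiv ℝ f x) (x + (0 : ℝ) • w) := by simpa using h0
    exact h1.comp_hasDerivAt (0 : ℝ) hline
  have hU : ∀ᶠ t : ℝ in nhdsWithin 0 (Set.Ioi 0), x + t • w ∈ U :=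
    nhdsWithin_le_nhds (hline.continuousAt.eventually_mem
      (by simpa using h.isOpen.mem_nhds hx))
  have hneg := (hasDerivAt_iff_tendsto_slope_zero.1 hd).mono_left
    (nhdsWithin_mono 0 fun t (ht : 0 < t) => ht.ne')
  filter_upwards [hU, hneg.eventually (gt_mem_nhds hw), self_mem_nhdsWithin] with t htU ht ht0
  rw [h.mem_iff _ htU]
  have ht0' : 0 < t := ht0
  simp only [zero_add, zero_smul, add_zero, smul_eq_mul] at ht
  have : f (x + t • w) - f x < 0 := by
    by_contra! hcon
    exact absurd ht (not_lt.2 (mul_nonneg (inv_nonneg.2 ht0'.le) hcon))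
  linarith

theorem apply_frontier (h : IsLocalDefiningFunction K U f) (hK : IsClosed K) (hx : x ∈ U)
    (hxf : x ∈ frontier K) : f x = 0 := by
  have hle : f x ≤ 0 := (h.mem_iff x hx).1 (hK.frontier_subset hxf)
  refine le_antisymm hle (not_lt.1 fun hlt => hxf.2 ?_)
  rw [mem_interior_iff_mem_nhds]
  filter_upwards [h.isOpen.mem_nhds hx,
    (h.contDiffAt hx).continuousAt.eventually (gt_mem_nhds hlt)] with y hy hfy
  exact (h.mem_iff y hy).2 hfy.le

/-- A zero of f interior to K would be a local maximum of f, hence a critical point. -/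
theorem mem_frontier (h : IsLocalDefiningFunction K U f) (hx : x ∈ U)
    (hfx : f x = 0) : x ∈ frontier K := by
  refine ⟨subset_closure ((h.mem_iff x hx).2 hfx.le), fun hint => ?_⟩
  have hmax : IsLocalMax f x := by
    filter_upwards [h.isOpen.mem_nhds hx, mem_interior_iff_mem_nhds.1 hint] with y hy hyK
    rw [hfx]
    exact (h.mem_iff y hy).1 hyK
  exact h.regular x hx hmax.fderiv_eq_zero

/-- With a positive slope, f would be positive just after x on the segment to y, which lies in K by
convexity. This makes the gradient define a supporting half-space. -/
theorem fderiv_sub_nonpos (h : IsLocalDefiningFunction K U f) (hc : Convex ℝ K) (hK : IsClosed K)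
    (hx : x ∈ U) (hxf : x ∈ frontier K) (hy : y ∈ K) : fderiv ℝ f x (y - x) ≤ 0 := by
  by_contra! hpos
  have hfx := h.apply_frontier hK hx hxf
  have hline : HasDerivAt (fun t : ℝ => x + t • (y - x)) (y - x) 0 := by
    simpa using ((hasDerivAt_id (0 : ℝ)).smul_const (y - x)).const_add x
  have hd : HasDerivAt (fun t : ℝ => f (x + t • (y - x))) (fderiv ℝ f x (y - x)) 0 := by
    have h0 := h.hasFDerivAt hx
    have h1 : HasFDerivAt f (fderiv ℝ f x) (x + (0 : ℝ) • (y - x)) := by simpa using h0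
    exact h1.comp_hasDerivAt (0 : ℝ) hline
  have hU : ∀ᶠ t : ℝ in nhdsWithin 0 (Set.Ioi 0), x + t • (y - x) ∈ U :=
    nhdsWithin_le_nhds (hline.continuousAt.eventually_mem
      (by simpa using h.isOpen.mem_nhds hx))
  have hlim := (hasDerivAt_iff_tendsto_slope_zero.1 hd).mono_left
    (nhdsWithin_mono 0 fun t (ht : 0 < t) => ht.ne')
  obtain ⟨t, htU, ht, ht01⟩ := (hU.and ((hlim.eventually (lt_mem_nhds hpos)).and
    (Ioo_mem_nhdsGT (zero_lt_one (α := ℝ))))).exists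
  have hmem : x + t • (y - x) ∈ K :=
    hc.add_smul_sub_mem (hK.frontier_subset hxf) hy ⟨ht01.1.le, ht01.2.le⟩
  have hle := (h.mem_iff _ htU).1 hmem
  simp only [zero_add, zero_smul, add_zero, smul_eq_mul, hfx, sub_zero] at ht
  exact absurd ht (not_lt.2 (mul_nonpos_of_nonneg_of_nonpos (inv_nonneg.2 ht01.1.le) hle))

/-- A unit vector that defines a supporting half-space at a boundary point is the normalized
gradient of any local defining function. -/
theorem normal_eq_of_inner_le (h : IsLocalDefiningFunction K U f) (hK : IsClosed K) (hx : x ∈ U)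
    (hxf : x ∈ frontier K) (hν : ‖ν‖ = 1) (hsup : ∀ y ∈ K, inner ℝ ν y ≤ inner ℝ ν x) :
    ‖gradient f x‖⁻¹ • gradient f x = ν := by
  -- Directions of negative slope enter K, where ⟨ν, ·⟩ does not exceed its value at x; so the open
  -- half-space of the gradient lies in the closed one of ν.
  refine eq_of_halfSpace_subset (h.norm_normal hx) hν fun w hw => ?_
  rw [real_inner_smul_left, inner_gradient] at hw
  have hw' : fderiv ℝ f x w < 0 := by
    by_contra! hcon
    exact absurd hw (not_lt.2 (mul_nonneg (by positivity) hcon))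
  obtain ⟨t, htK, ht⟩ := ((h.eventually_add_smul_mem hx
    (h.apply_frontier hK hx hxf).le hw').and self_mem_nhdsWithin).exists
  have ht0 : 0 < t := ht
  have := hsup _ htK
  rw [inner_add_right, real_inner_smul_right] at this
  by_contra! hcon
  have := mul_pos ht0 hcon
  linarith

end IsLocalDefiningFunction

theorem mem_frontier_of_inner_le (hν : ‖ν‖ = 1) (hx : x ∈ K)
    (hsup : ∀ y ∈ K, inner ℝ ν y ≤ inner ℝ ν x) : x ∈ frontier K := by
  refine ⟨subset_closure hx, fun hint => ?_⟩
  have hc : ContinuousAt (fun t : ℝ => x + t • ν) 0 := by fun_prop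
  have hev : ∀ᶠ t : ℝ in nhdsWithin 0 (Set.Ioi 0), x + t • ν ∈ K :=
    nhdsWithin_le_nhds (hc.eventually_mem (by simpa using mem_interior_iff_mem_nhds.1 hint))
  obtain ⟨t, htK, ht⟩ := (hev.and self_mem_nhdsWithin).exists
  have ht0 : 0 < t := ht
  have := hsup _ htK
  rw [inner_add_right, real_inner_smul_right, real_inner_self_eq_norm_sq, hν] at this
  linarith

namespace IsBilliardTable

theorem isClosed (hK : IsBilliardTable K) : IsClosed K := hK.compact.isClosed

/-- The outer unit normals are the unit vectors that define a supporting half-space. -/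
theorem isOuterUnitNormal_iff (hK : IsBilliardTable K) :
    IsOuterUnitNormal K x ν ↔
      x ∈ frontier K ∧ ‖ν‖ = 1 ∧ ∀ y ∈ K, inner ℝ ν y ≤ inner ℝ ν x := by
  constructor
  · rintro ⟨hxf, U, f, h, hx, rfl⟩
    refine ⟨hxf, h.norm_normal hx, fun y hy => ?_⟩
    have h1 := h.fderiv_sub_nonpos hK.convex hK.isClosed hx hxf hy
    rw [← inner_gradient, inner_sub_right] at h1
    rw [real_inner_smul_left, real_inner_smul_left]
    exact mul_le_mul_of_nonneg_left (by linarith) (by positivity)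
  · rintro ⟨hxf, hν, hsup⟩
    obtain ⟨U, f, h, hx⟩ := hK.smooth_boundary x hxf
    exact ⟨hxf, U, f, h, hx, (h.normal_eq_of_inner_le hK.isClosed hx hxf hν hsup).symm⟩

theorem outerUnitNormal_unique (hK : IsBilliardTable K) (h : IsOuterUnitNormal K x ν)
    (h' : IsOuterUnitNormal K x ν') : ν = ν' := by
  obtain ⟨hxf, U, f, hf, hx, rfl⟩ := h
  obtain ⟨-, hν, hsup⟩ := hK.isOuterUnitNormal_iff.1 h'
  exact hf.normal_eq_of_inner_le hK.isClosed hx hxf hν hsup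

theorem isOuterUnitNormal_gaussMap (hK : IsBilliardTable K) (hx : x ∈ frontier K) :
    IsOuterUnitNormal K x (gaussMap K x) := by
  obtain ⟨U, f, h, hxU⟩ := hK.smooth_boundary x hx
  exact Classical.epsilon_spec (p := fun ν => IsOuterUnitNormal K x ν)
    ⟨_, hx, U, f, h, hxU, rfl⟩

theorem gaussMap_eq (hK : IsBilliardTable K) (h : IsOuterUnitNormal K x ν) : gaussMap K x = ν :=
  hK.outerUnitNormal_unique (hK.isOuterUnitNormal_gaussMap h.1) h

theorem norm_gaussMap (hK : IsBilliardTable K) (hx : x ∈ frontier K) : ‖gaussMap K x‖ = 1 :=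
  (hK.isOuterUnitNormal_iff.1 (hK.isOuterUnitNormal_gaussMap hx)).2.1

theorem inner_gaussMap_le (hK : IsBilliardTable K) (hx : x ∈ frontier K) (hy : y ∈ K) :
    inner ℝ (gaussMap K x) y ≤ inner ℝ (gaussMap K x) x :=
  (hK.isOuterUnitNormal_iff.1 (hK.isOuterUnitNormal_gaussMap hx)).2.2 y hy

theorem gradient_eq_smul (hK : IsBilliardTable K) (h : IsLocalDefiningFunction K U f) (hx : x ∈ U)
    (hxν : IsOuterUnitNormal K x ν) : gradient f x = ‖gradient f x‖ • ν := by
  have := hK.outerUnitNormal_unique ⟨hxν.1, U, f, h, hx, rfl⟩ hxν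
  rw [← this, smul_inv_smul₀ (h.norm_gradient_pos hx).ne']

/-- A linear form is strictly smaller in the interior than at a boundary point it supports. -/
theorem inner_gaussMap_lt (hK : IsBilliardTable K) (hx : x ∈ frontier K) (hy : y ∈ interior K) :
    inner ℝ (gaussMap K x) y < inner ℝ (gaussMap K x) x := by
  set ν := gaussMap K x
  have hc : ContinuousAt (fun t : ℝ => y + t • ν) 0 := by fun_prop
  have hev : ∀ᶠ t : ℝ in nhdsWithin 0 (Set.Ioi 0), y + t • ν ∈ K :=
    nhdsWithin_le_nhds (hc.eventually_mem (by simpa using mem_interior_iff_mem_nhds.1 hy))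
  obtain ⟨t, htK, ht⟩ := (hev.and self_mem_nhdsWithin).exists
  have ht0 : 0 < t := ht
  have := hK.inner_gaussMap_le hx htK
  rw [inner_add_right, real_inner_smul_right, real_inner_self_eq_norm_sq] at this
  rw [hK.norm_gaussMap hx] at this
  linarith

/-- The second fundamental form is positive definite. -/
theorem fderiv_fderiv_pos (hK : IsBilliardTable K) (h : IsLocalDefiningFunction K U f) (hx : x ∈ U)
    (hxf : x ∈ frontier K) {v : EuclideanSpace ℝ (Fin (k + 1))} (hv : fderiv ℝ f x v = 0)
    (hv0 : v ≠ 0) : 0 < fderiv ℝ (fderiv ℝ f) x v v := by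
  have hn : 0 < ‖fderiv ℝ f x‖ := norm_pos_iff.2 (h.regular x hx)
  refine bilin_pos_of_eigenvalues_pos (fderiv ℝ f x).ker (fderiv ℝ (fderiv ℝ f) x)
    (h.fderiv_fderiv_symm hx) (fun κ u hu hu0 hκ => ?_) (by simpa using hv) hv0
  -- An eigenvalue of D²f on the tangent space becomes a principal curvature after division by ‖Df‖.
  have : 0 < κ / ‖fderiv ℝ f x‖ := by
    refine hK.curvature_pos x _ ⟨hxf, U, f, h, hx, u, hu0, by simpa using hu, fun w hw => ?_⟩
    rw [hκ w (by simpa using hw)]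
    ring
  exact (div_pos_iff_of_pos_right hn).1 this

theorem isOuterUnitNormal_of_inner_le (hK : IsBilliardTable K) (hν : ‖ν‖ = 1) (hx : x ∈ K)
    (hsup : ∀ y ∈ K, inner ℝ ν y ≤ inner ℝ ν x) : IsOuterUnitNormal K x ν :=
  hK.isOuterUnitNormal_iff.2 ⟨mem_frontier_of_inner_le hν hx hsup, hν, hsup⟩

/-- Boundary points with the same outer unit normal coincide. -/
theorem eq_of_isOuterUnitNormal (hK : IsBilliardTable K) (hx : IsOuterUnitNormal K x ν)
    (hy : IsOuterUnitNormal K y ν) : x = y := by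
  by_contra hne
  obtain ⟨hxf, hν, hxs⟩ := hK.isOuterUnitNormal_iff.1 hx
  obtain ⟨hyf, -, hys⟩ := hK.isOuterUnitNormal_iff.1 hy
  have hxK := hK.isClosed.frontier_subset hxf
  have hyK := hK.isClosed.frontier_subset hyf
  have heq : inner ℝ ν x = inner ℝ ν y := le_antisymm (hys x hxK) (hxs y hyK)
  obtain ⟨U, f, h, hxU⟩ := hK.smooth_boundary x hxf
  set v := y - x with hvdef
  have hνv : inner ℝ ν v = 0 := by rw [hvdef, inner_sub_right, heq, sub_self]
  have hzero : ∀ z ∈ U, IsOuterUnitNormal K z ν → fderiv ℝ f z v = 0 := fun z hz hzν => by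
    rw [← inner_gradient, hK.gradient_eq_smul h hz hzν, real_inner_smul_left, hνv, mul_zero]
  have hpos := hK.fderiv_fderiv_pos h hxU hxf (hzero x hxU hx) (sub_ne_zero.2 (Ne.symm hne))
  have hline : HasDerivAt (fun t : ℝ => x + t • v) v 0 := by
    simpa using ((hasDerivAt_id (0 : ℝ)).smul_const v).const_add x
  have hd : HasDerivAt (fun t : ℝ => fderiv ℝ f (x + t • v) v)
      (fderiv ℝ (fderiv ℝ f) x v v) 0 := by
    have h0 := h.hasFDerivAt_fderiv hxU
    have h1 : HasFDerivAt (fderiv ℝ f) (fderiv ℝ (fderiv ℝ f) x) (x + (0 : ℝ) • v) := by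
      simpa using h0
    have h2 := h1.comp_hasDerivAt (0 : ℝ) hline
    simpa using h2.clm_apply (hasDerivAt_const (0 : ℝ) v)
  have hU : ∀ᶠ t : ℝ in nhdsWithin 0 (Set.Ici 0), x + t • v ∈ U :=
    nhdsWithin_le_nhds (hline.continuousAt.eventually_mem
      (by simpa using h.isOpen.mem_nhds hxU))
  -- Every point of the segment from x to y maximizes ⟨ν, ·⟩ on K, so ν is normal there and Df kills
  -- v. Differentiating from the right at t = 0 gives D²f(v, v) = 0, against positive definiteness.
  have hev : (fun t : ℝ => fderiv ℝ f (x + t • v) v) =ᶠ[nhdsWithin 0 (Set.Ici 0)]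
      fun _ => 0 := by
    filter_upwards [hU, Icc_mem_nhdsGE (zero_lt_one (α := ℝ))] with t htU ht
    refine hzero _ htU (hK.isOuterUnitNormal_of_inner_le hν
      (hK.convex.add_smul_sub_mem hxK hyK ht) fun z hz => ?_)
    rw [inner_add_right, real_inner_smul_right, hνv, mul_zero, add_zero]
    exact hxs z hz
  have hd0 : HasDerivWithinAt (fun t : ℝ => fderiv ℝ f (x + t • v) v) 0 (Set.Ici 0) 0 :=
    (hasDerivWithinAt_const (0 : ℝ) (Set.Ici 0) (0 : ℝ)).congr_of_eventuallyEq hev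
      (by simpa using hzero x hxU hx)
  exact hpos.ne' ((uniqueDiffWithinAt_Ici (0 : ℝ)).eq_deriv _ hd.hasDerivWithinAt hd0)

theorem exists_isOuterUnitNormal (hK : IsBilliardTable K) (hν : ‖ν‖ = 1) :
    ∃ x, IsOuterUnitNormal K x ν := by
  have hne : K.Nonempty := hK.interior_nonempty.mono interior_subset
  obtain ⟨x, hx, hmax⟩ := hK.compact.exists_isMaxOn hne
    (f := fun y => inner ℝ ν y) (by fun_prop)
  exact ⟨x, hK.isOuterUnitNormal_of_inner_le hν hx fun y hy => hmax hy⟩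

theorem bijOn_gaussMap (hK : IsBilliardTable K) :
    Set.BijOn (gaussMap K) (frontier K) (sphere 0 1) := by
  refine ⟨fun x hx => by simpa using hK.norm_gaussMap hx, fun x hx y hy hxy => ?_, fun ν hν => ?_⟩
  · have h1 := hK.isOuterUnitNormal_gaussMap hx
    rw [hxy] at h1
    exact hK.eq_of_isOuterUnitNormal h1 (hK.isOuterUnitNormal_gaussMap hy)
  · obtain ⟨x, hx⟩ := hK.exists_isOuterUnitNormal (ν := ν) (by simpa using hν)
    exact ⟨x, hx.1, hK.gaussMap_eq hx⟩

theorem isOuterUnitNormal_gaussInv (hK : IsBilliardTable K) (hν : ‖ν‖ = 1) :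
    IsOuterUnitNormal K (gaussInv K ν) ν := by
  have h : ν ∈ gaussMap K '' frontier K := hK.bijOn_gaussMap.surjOn (by simpa using hν)
  have h1 := hK.isOuterUnitNormal_gaussMap (Function.invFunOn_mem h)
  rwa [Function.invFunOn_eq h] at h1

theorem gaussInv_eq (hK : IsBilliardTable K) (h : IsOuterUnitNormal K x ν) : gaussInv K ν = x :=
  hK.eq_of_isOuterUnitNormal
    (hK.isOuterUnitNormal_gaussInv (hK.isOuterUnitNormal_iff.1 h).2.1) h

theorem supportFun_eq (hK : IsBilliardTable K) (hν : ‖ν‖ = 1) :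
    supportFun K ν = inner ℝ (gaussInv K ν) ν := by
  obtain ⟨hf, -, hs⟩ := hK.isOuterUnitNormal_iff.1 (hK.isOuterUnitNormal_gaussInv hν)
  refine IsGreatest.csSup_eq ⟨⟨_, hK.isClosed.frontier_subset hf, rfl⟩, ?_⟩
  rintro _ ⟨y, hy, rfl⟩
  simpa only [real_inner_comm] using hs y hy

end IsBilliardTable

end Boundary

/-! ### Smoothness and differential of the support point -/

section SupportPoint

/-- The Riesz isomorphism of a finite-dimensional real inner product space, as a linear map from
covectors to vectors. -/
noncomputable def rieszVector (E : Type*) [NormedAddCommGroup E] [InnerProductSpace ℝ E]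
    [FiniteDimensional ℝ E] : (E →L[ℝ] ℝ) →L[ℝ] E :=
  haveI : CompleteSpace E := FiniteDimensional.complete ℝ E
  LinearMap.toContinuousLinearMap
    { toFun := fun φ => (InnerProductSpace.toDual ℝ E).symm φ
      map_add' := fun a b => by simp
      map_smul' := fun c a => by simp }

/-- The Riesz isomorphism of a finite-dimensional real inner product space, as a linear map from
vectors to covectors. -/
noncomputable def rieszCovector (E : Type*) [NormedAddCommGroup E] [InnerProductSpace ℝ E]
    [FiniteDimensional ℝ E] : E →L[ℝ] (E →L[ℝ] ℝ) :=
  LinearMap.toContinuousLinearMap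
    { toFun := fun v => innerSL ℝ v
      map_add' := fun a b => by simp
      map_smul' := fun c a => by simp }

variable {k : ℕ} {K U : Set (EuclideanSpace ℝ (Fin (k + 1)))}
  {f : EuclideanSpace ℝ (Fin (k + 1)) → ℝ}
  {x v w : EuclideanSpace ℝ (Fin (k + 1))}

theorem inner_rieszVector (φ : EuclideanSpace ℝ (Fin (k + 1)) →L[ℝ] ℝ)
    (w : EuclideanSpace ℝ (Fin (k + 1))) :
    inner ℝ (rieszVector (EuclideanSpace ℝ (Fin (k + 1))) φ) w = φ w := by
  simp [rieszVector]

@[simp]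
theorem rieszCovector_apply (v w : EuclideanSpace ℝ (Fin (k + 1))) :
    rieszCovector (EuclideanSpace ℝ (Fin (k + 1))) v w = inner ℝ v w := by
  simp [rieszCovector]

/-- The boundary point whose outer normal is a positive multiple of `v`. -/
noncomputable def supportPoint (K : Set (EuclideanSpace ℝ (Fin (k + 1))))
    (v : EuclideanSpace ℝ (Fin (k + 1))) : EuclideanSpace ℝ (Fin (k + 1)) :=
  gaussInv K (‖v‖⁻¹ • v)

/-- The extension of the support function from the unit sphere that is positively homogeneous of
degree one. -/
noncomputable def homogeneousSupportFun (K : Set (EuclideanSpace ℝ (Fin (k + 1))))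
    (v : EuclideanSpace ℝ (Fin (k + 1))) : ℝ :=
  supportFun K (‖v‖⁻¹ • v) * ‖v‖

namespace IsBilliardTable

theorem isOuterUnitNormal_supportPoint (hK : IsBilliardTable K) (hv : v ≠ 0) :
    IsOuterUnitNormal K (supportPoint K v) (‖v‖⁻¹ • v) :=
  hK.isOuterUnitNormal_gaussInv (norm_smul_inv_norm hv)

theorem supportPoint_mem_frontier (hK : IsBilliardTable K) (hv : v ≠ 0) :
    supportPoint K v ∈ frontier K := (hK.isOuterUnitNormal_supportPoint hv).1

theorem supportPoint_mem (hK : IsBilliardTable K) (hv : v ≠ 0) : supportPoint K v ∈ K :=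
  hK.isClosed.frontier_subset (hK.supportPoint_mem_frontier hv)

theorem homogeneousSupportFun_eq (hK : IsBilliardTable K) (hv : v ≠ 0) :
    homogeneousSupportFun K v = inner ℝ (supportPoint K v) v := by
  rw [homogeneousSupportFun, hK.supportFun_eq (show ‖‖v‖⁻¹ • v‖ = 1 from norm_smul_inv_norm hv),
    real_inner_smul_right, supportPoint]
  field_simp [norm_ne_zero_iff.2 hv]

theorem inner_le_homogeneousSupportFun (hK : IsBilliardTable K) (hv : v ≠ 0) (hx : x ∈ K) :
    inner ℝ x v ≤ homogeneousSupportFun K v := by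
  have h := (hK.isOuterUnitNormal_iff.1 (hK.isOuterUnitNormal_supportPoint hv)).2.2 x hx
  rw [real_inner_smul_left, real_inner_smul_left] at h
  rw [hK.homogeneousSupportFun_eq hv, real_inner_comm, real_inner_comm v]
  exact le_of_mul_le_mul_left h (inv_pos.2 (norm_pos_iff.2 hv))

theorem supportPoint_eq_of_gradient (hK : IsBilliardTable K) (h : IsLocalDefiningFunction K U f)
    (hx : x ∈ U) (hfx : f x = 0) {s : ℝ} (hs : 0 < s) (hv : s • gradient f x = v) :
    supportPoint K v = x := by
  refine hK.gaussInv_eq ⟨h.mem_frontier hx hfx, U, f, h, hx, ?_⟩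
  rw [← hv, norm_smul, Real.norm_of_nonneg hs.le, smul_smul, mul_inv, mul_assoc,
    mul_comm _ s, ← mul_assoc, inv_mul_cancel₀ hs.ne', one_mul]

/-- The map `(x, s) ↦ (s ∇f(x), f(x))` is a local diffeomorphism at boundary points. -/
theorem exists_hasFDerivAt_smul_gradient (hK : IsBilliardTable K)
    (h : IsLocalDefiningFunction K U f) (hx : x ∈ U) (hxf : x ∈ frontier K) {s : ℝ} (hs : 0 < s) :
    ∃ A : (EuclideanSpace ℝ (Fin (k + 1)) × ℝ) ≃L[ℝ] (EuclideanSpace ℝ (Fin (k + 1)) × ℝ),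
      HasFDerivAt (fun p : EuclideanSpace ℝ (Fin (k + 1)) × ℝ => (p.2 • gradient f p.1, f p.1))
        (A : (EuclideanSpace ℝ (Fin (k + 1)) × ℝ) →L[ℝ] (EuclideanSpace ℝ (Fin (k + 1)) × ℝ))
        (x, s) := by
  set R := rieszVector (EuclideanSpace ℝ (Fin (k + 1)))
  have hfst : HasFDerivAt (Prod.fst : EuclideanSpace ℝ (Fin (k + 1)) × ℝ → _) _ (x, s) :=
    hasFDerivAt_fst (𝕜 := ℝ)
  have hsnd : HasFDerivAt (Prod.snd : EuclideanSpace ℝ (Fin (k + 1)) × ℝ → _) _ (x, s) :=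
    hasFDerivAt_snd (𝕜 := ℝ)
  have hgrad : HasFDerivAt (gradient f) (R.comp (fderiv ℝ (fderiv ℝ f) x)) x :=
    R.hasFDerivAt.comp x (h.hasFDerivAt_fderiv hx)
  have hD := (hsnd.smul (HasFDerivAt.comp (x, s) (g := gradient f) hgrad hfst)).prodMk
    (HasFDerivAt.comp (x, s) (g := f) (h.hasFDerivAt hx) hfst)
  set D := _
  change HasFDerivAt _ D _ at hD
  have hDapp : ∀ ξ σ, D (ξ, σ) =
      (s • R (fderiv ℝ (fderiv ℝ f) x ξ) + σ • gradient f x, fderiv ℝ f x ξ) := fun ξ σ => by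
    simp [D]
  have hinj : Function.Injective D.toLinearMap := by
    rw [← LinearMap.ker_eq_bot, LinearMap.ker_eq_bot']
    rintro ⟨ξ, σ⟩ hξ
    have hξ' : D (ξ, σ) = 0 := hξ
    rw [hDapp, Prod.mk_eq_zero] at hξ'
    obtain ⟨h1, h2⟩ := hξ'
    -- Since ξ is tangent, pairing with ξ removes the gradient term and leaves s D²f(ξ, ξ) = 0.
    have h3 := congrArg (fun z => inner ℝ z ξ) h1
    simp only [inner_add_left, real_inner_smul_left, R, inner_rieszVector, inner_gradient, h2,
      mul_zero, add_zero, inner_zero_left] at h3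
    have hξ0 : ξ = 0 := by
      by_contra hne
      exact (mul_pos hs (hK.fderiv_fderiv_pos h hx hxf h2 hne)).ne' h3
    subst hξ0
    have hσ : σ = 0 := by
      simpa [h.gradient_ne_zero hx] using h1
    simp [hσ]
  refine ⟨(LinearEquiv.ofInjectiveEndo D.toLinearMap hinj).toContinuousLinearEquiv, ?_⟩
  have hcoe : ((LinearEquiv.ofInjectiveEndo D.toLinearMap hinj).toContinuousLinearEquiv :
      (EuclideanSpace ℝ (Fin (k + 1)) × ℝ) →L[ℝ] (EuclideanSpace ℝ (Fin (k + 1)) × ℝ)) = D :=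
    ContinuousLinearMap.ext fun _ => rfl
  rw [hcoe]
  exact hD

/-- Apply the inverse function theorem to Φ(x, s) = (s∇f(x), f(x)). Near v, the first component of
the local inverse at (u, 0) is a zero of f whose gradient is a positive multiple of u, hence the
support point of u. -/
theorem contDiffAt_supportPoint (hK : IsBilliardTable K) (hv : v ≠ 0) :
    ContDiffAt ℝ ∞ (supportPoint K) v := by
  have hn := hK.isOuterUnitNormal_supportPoint hv
  obtain ⟨U, f, h, hx⟩ := hK.smooth_boundary _ hn.1
  set x := supportPoint K v
  have hfx := h.apply_frontier hK.isClosed hx hn.1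
  set s := ‖v‖ / ‖gradient f x‖ with hsdef
  have hvpos := norm_pos_iff.2 hv
  have hs : 0 < s := div_pos hvpos (h.norm_gradient_pos hx)
  have hsv : s • gradient f x = v := by
    rw [hK.gradient_eq_smul h hx hn, smul_smul, smul_smul, hsdef,
      div_mul_cancel₀ _ (h.norm_gradient_pos hx).ne', mul_inv_cancel₀ hvpos.ne', one_smul]
  obtain ⟨A, hA⟩ := hK.exists_hasFDerivAt_smul_gradient h hx hn.1 hs
  set Φ := fun p : EuclideanSpace ℝ (Fin (k + 1)) × ℝ => (p.2 • gradient f p.1, f p.1) with hΦ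
  have hgrad : ContDiffAt ℝ ∞ (gradient f) x :=
    (rieszVector (EuclideanSpace ℝ (Fin (k + 1)))).contDiff.contDiffAt.comp x
      (h.contDiffAt_fderiv hx)
  have hsmooth : ContDiffAt ℝ ∞ Φ (x, s) :=
    (contDiffAt_snd.smul (ContDiffAt.comp (x, s) (g := gradient f) hgrad contDiffAt_fst)).prodMk
      (ContDiffAt.comp (x, s) (g := f) (h.contDiffAt hx) contDiffAt_fst)
  have hΦv : Φ (x, s) = (v, 0) := by simp [hΦ, hsv, hfx]
  set g := hsmooth.localInverse hA (by simp) with hg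
  have hgs : ContDiffAt ℝ ∞ g (v, 0) := by
    simpa only [hΦv] using hsmooth.to_localInverse hA (by simp)
  have hgv : g (v, 0) = (x, s) := by
    rw [← hΦv]; exact hsmooth.localInverse_apply_image hA (by simp)
  have hright : ∀ᶠ y in nhds (v, (0 : ℝ)), Φ (g y) = y := by
    rw [← hΦv]
    exact (hsmooth.hasStrictFDerivAt' hA (by simp)).eventually_right_inverse
  have hpair : ContDiffAt ℝ ∞ (fun u : EuclideanSpace ℝ (Fin (k + 1)) => (u, (0 : ℝ))) v :=
    contDiffAt_id.prodMk contDiffAt_const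
  have hgp : ContDiffAt ℝ ∞ (fun u : EuclideanSpace ℝ (Fin (k + 1)) => g (u, 0)) v :=
    ContDiffAt.comp v (g := g) hgs hpair
  have hmem : (g (v, 0)).1 ∈ U ∧ 0 < (g (v, 0)).2 := by rw [hgv]; exact ⟨hx, hs⟩
  have h1 := hgp.fst.continuousAt.eventually_mem (h.isOpen.mem_nhds hmem.1)
  have h2 := hgp.snd.continuousAt.eventually (lt_mem_nhds hmem.2)
  refine hgp.fst.congr_of_eventuallyEq ?_
  filter_upwards [h1, h2, hpair.continuousAt.eventually hright] with u hu1 hu2 hu3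
  rw [hΦ, Prod.mk.injEq] at hu3
  exact hK.supportPoint_eq_of_gradient h hu1 hu3.2 hu2 hu3.1

theorem contDiffAt_homogeneousSupportFun (hK : IsBilliardTable K) (hv : v ≠ 0) :
    ContDiffAt ℝ ∞ (homogeneousSupportFun K) v := by
  refine ((hK.contDiffAt_supportPoint hv).inner ℝ contDiffAt_id).congr_of_eventuallyEq ?_
  filter_upwards [isOpen_ne.mem_nhds hv] with u hu
  exact hK.homogeneousSupportFun_eq hu

/-- Envelope argument: H dominates the linear form of the fixed point P(v), with equality at v, so
their difference has a local minimum there. -/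
theorem hasFDerivAt_homogeneousSupportFun (hK : IsBilliardTable K) (hv : v ≠ 0) :
    HasFDerivAt (homogeneousSupportFun K) (innerSL ℝ (supportPoint K v)) v := by
  have hd := ((hK.contDiffAt_homogeneousSupportFun hv).differentiableAt (by simp)).hasFDerivAt
  have hmin : IsLocalMin (fun u => homogeneousSupportFun K u - innerSL ℝ (supportPoint K v) u) v := by
    filter_upwards [isOpen_ne.mem_nhds hv] with u hu
    simp only [innerSL_apply_apply]
    rw [hK.homogeneousSupportFun_eq hv, sub_self, sub_nonneg]
    exact hK.inner_le_homogeneousSupportFun hu (hK.supportPoint_mem hv)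
  have h0 := hmin.hasFDerivAt_eq_zero (hd.sub (innerSL ℝ (supportPoint K v)).hasFDerivAt)
  rwa [sub_eq_zero.1 h0] at hd

theorem hasFDerivAt_supportPoint (hK : IsBilliardTable K) (hv : v ≠ 0) :
    HasFDerivAt (supportPoint K) (fderiv ℝ (supportPoint K) v) v :=
  ((hK.contDiffAt_supportPoint hv).differentiableAt (by simp)).hasFDerivAt

/-- Differentiate H(u) = ⟨P(u), u⟩ by the product rule and compare with dH = ⟨P(v), ·⟩. -/
theorem inner_fderiv_supportPoint (hK : IsBilliardTable K) (hv : v ≠ 0)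
    (w : EuclideanSpace ℝ (Fin (k + 1))) :
    inner ℝ (fderiv ℝ (supportPoint K) v w) v = 0 := by
  have h1 := (hK.hasFDerivAt_supportPoint hv).inner ℝ (hasFDerivAt_id v)
  have h2 := h1.congr_of_eventuallyEq (f₁ := homogeneousSupportFun K) (by
    filter_upwards [isOpen_ne.mem_nhds hv] with u hu
    exact hK.homogeneousSupportFun_eq hu)
  have h3 := congrArg (fun L => L w) (h2.unique (hK.hasFDerivAt_homogeneousSupportFun hv))
  simpa using h3

/-- Near v one has u = |u| N(P(u)), with N the normalized gradient. If dP kills w, differentiating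
along w leaves only the variation of |u|, a multiple of N(P(v)) = v/|v|. -/
theorem exists_eq_smul_of_fderiv_supportPoint_eq_zero (hK : IsBilliardTable K) (hv : v ≠ 0)
    (hw : fderiv ℝ (supportPoint K) v w = 0) : ∃ c : ℝ, w = c • v := by
  have hn := hK.isOuterUnitNormal_supportPoint hv
  obtain ⟨U, f, h, hx⟩ := hK.smooth_boundary _ hn.1
  have hgrad : DifferentiableAt ℝ (gradient f) (supportPoint K v) :=
    (rieszVector (EuclideanSpace ℝ (Fin (k + 1)))).differentiableAt.comp _
      (h.hasFDerivAt_fderiv hx).differentiableAt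
  have hN : DifferentiableAt ℝ (fun y => ‖gradient f y‖⁻¹ • gradient f y) (supportPoint K v) :=
    ((hgrad.norm ℝ (h.gradient_ne_zero hx)).inv (h.norm_gradient_pos hx).ne').smul hgrad
  have hnorm : DifferentiableAt ℝ (fun u : EuclideanSpace ℝ (Fin (k + 1)) => ‖u‖) v :=
    differentiableAt_id.norm ℝ hv
  have hd := hnorm.hasFDerivAt.smul
    (HasFDerivAt.comp v hN.hasFDerivAt (hK.hasFDerivAt_supportPoint hv))
  have hid := hd.congr_of_eventuallyEq (f₁ := id) (by
    filter_upwards [isOpen_ne.mem_nhds hv, (hK.hasFDerivAt_supportPoint hv).continuousAt.eventually_mem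
      (h.isOpen.mem_nhds hx)] with u hu huU
    have hun := hK.isOuterUnitNormal_supportPoint hu
    have := hK.outerUnitNormal_unique hun ⟨hun.1, U, f, h, huU, rfl⟩
    simp only [Pi.smul_apply', Function.comp_apply, id_eq]
    rw [← this, smul_inv_smul₀ (norm_ne_zero_iff.2 hu)])
  have hv' : ‖gradient f (supportPoint K v)‖⁻¹ • gradient f (supportPoint K v) = ‖v‖⁻¹ • v :=
    hK.outerUnitNormal_unique ⟨hn.1, U, f, h, hx, rfl⟩ hn
  have h3 := congrArg (fun L => L w) ((hasFDerivAt_id v).unique hid)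
  simp only [ContinuousLinearMap.id_apply, add_apply,
    smul_apply, ContinuousLinearMap.comp_apply, hw, map_zero, smul_zero,
    zero_add, ContinuousLinearMap.smulRight_apply, Function.comp_apply, hv', smul_smul] at h3
  exact ⟨_, h3⟩

end IsBilliardTable

end SupportPoint

/-! ### Tangent vectors and covectors of the sphere -/

section SphereCalculus

theorem fact_finrank_euclideanSpace (k : ℕ) :
    Fact (finrank ℝ (EuclideanSpace ℝ (Fin (k + 1))) = k + 1) := ⟨finrank_euclideanSpace_fin⟩

/-- The differential at `n` of the inclusion of the unit sphere into Euclidean space. -/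
noncomputable def sphereInclDeriv {k : ℕ} (n : sphere (0 : EuclideanSpace ℝ (Fin (k + 1))) 1) :
    EuclideanSpace ℝ (Fin k) →L[ℝ] EuclideanSpace ℝ (Fin (k + 1)) :=
  mfderiv (𝓡 k) 𝓘(ℝ, EuclideanSpace ℝ (Fin (k + 1)))
    (fun n : sphere (0 : EuclideanSpace ℝ (Fin (k + 1))) 1 =>
      (n : EuclideanSpace ℝ (Fin (k + 1)))) n

variable {k : ℕ} {n : sphere (0 : EuclideanSpace ℝ (Fin (k + 1))) 1}

theorem hasMFDerivAt_sphereIncl (n : sphere (0 : EuclideanSpace ℝ (Fin (k + 1))) 1) :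
    HasMFDerivAt (𝓡 k) 𝓘(ℝ, EuclideanSpace ℝ (Fin (k + 1)))
      (fun n : sphere (0 : EuclideanSpace ℝ (Fin (k + 1))) 1 =>
        (n : EuclideanSpace ℝ (Fin (k + 1)))) n (sphereInclDeriv n) :=
  haveI := fact_finrank_euclideanSpace k
  ((contMDiff_coe_sphere (m := 1) n).mdifferentiableAt one_ne_zero).hasMFDerivAt

theorem sphereInclDeriv_injective (n : sphere (0 : EuclideanSpace ℝ (Fin (k + 1))) 1) :
    Function.Injective (sphereInclDeriv n) :=
  haveI := fact_finrank_euclideanSpace k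
  injective_mvfderiv_subtypeVal_sphere n

theorem range_sphereInclDeriv (n : sphere (0 : EuclideanSpace ℝ (Fin (k + 1))) 1) :
    (sphereInclDeriv n).range = (Submodule.span ℝ {(n : EuclideanSpace ℝ (Fin (k + 1)))})ᗮ :=
  haveI := fact_finrank_euclideanSpace k
  range_mvfderiv_subtypeVal n

theorem inner_sphereInclDeriv (n : sphere (0 : EuclideanSpace ℝ (Fin (k + 1))) 1)
    (ξ : EuclideanSpace ℝ (Fin k)) :
    inner ℝ (n : EuclideanSpace ℝ (Fin (k + 1))) (sphereInclDeriv n ξ) = 0 := by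
  have h : sphereInclDeriv n ξ ∈ (sphereInclDeriv n).range := ⟨ξ, rfl⟩
  rwa [range_sphereInclDeriv, Submodule.mem_orthogonal_singleton_iff_inner_right] at h

theorem sphere_norm_eq (n : sphere (0 : EuclideanSpace ℝ (Fin (k + 1))) 1) :
    ‖(n : EuclideanSpace ℝ (Fin (k + 1)))‖ = 1 := by simp

/-- A vector orthogonal to the tangent space of the sphere at `n` is a multiple of `n`. -/
theorem eq_inner_smul_of_forall_inner_eq_zero {a : EuclideanSpace ℝ (Fin (k + 1))}
    (h : ∀ ξ, inner ℝ a (sphereInclDeriv n ξ) = 0) :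
    a = inner ℝ a (n : EuclideanSpace ℝ (Fin (k + 1))) • (n : EuclideanSpace ℝ (Fin (k + 1))) := by
  have hn := sphere_norm_eq n
  have hb : a - inner ℝ a (n : EuclideanSpace ℝ (Fin (k + 1))) •
      (n : EuclideanSpace ℝ (Fin (k + 1))) ∈ (sphereInclDeriv n).range := by
    rw [range_sphereInclDeriv, Submodule.mem_orthogonal_singleton_iff_inner_left, inner_sub_left,
      real_inner_smul_left, real_inner_self_eq_norm_sq, hn]
    ring
  obtain ⟨ξ, hξ⟩ := hb
  have hξ' : sphereInclDeriv n ξ = a - inner ℝ a (n : EuclideanSpace ℝ (Fin (k + 1))) •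
      (n : EuclideanSpace ℝ (Fin (k + 1))) := hξ
  have h0 : inner ℝ (sphereInclDeriv n ξ) (sphereInclDeriv n ξ) = 0 := by
    nth_rewrite 1 [hξ']
    rw [inner_sub_left, real_inner_smul_left, h, inner_sphereInclDeriv]
    ring
  rw [inner_self_eq_zero.1 h0] at hξ'
  exact sub_eq_zero.1 hξ'.symm

/-- The tangential covector of `P` at `n` determines the foot of the line through `P`. -/
theorem innerSL_comp_sphereInclDeriv_eq_iff {m P : EuclideanSpace ℝ (Fin (k + 1))}
    (hm : inner ℝ m (n : EuclideanSpace ℝ (Fin (k + 1))) = 0) :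
    (innerSL ℝ m).comp (sphereInclDeriv n) = (innerSL ℝ P).comp (sphereInclDeriv n) ↔
      m = P - inner ℝ P (n : EuclideanSpace ℝ (Fin (k + 1))) •
        (n : EuclideanSpace ℝ (Fin (k + 1))) := by
  constructor
  · intro h
    have h1 := eq_inner_smul_of_forall_inner_eq_zero (n := n) (a := P - m) fun ξ => by
      have := congrArg (fun L => L ξ) h
      simp only [ContinuousLinearMap.comp_apply, innerSL_apply_apply] at this
      rw [inner_sub_left, this, sub_self]
    rw [inner_sub_left, hm, sub_zero] at h1
    rw [← h1]
    abel
  · rintro rfl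
    ext ξ
    simp only [ContinuousLinearMap.comp_apply, innerSL_apply_apply]
    rw [inner_sub_left, real_inner_smul_left, inner_sphereInclDeriv, mul_zero, sub_zero]

theorem bijective_of_forall_eq_zero {F : Type*} [NormedAddCommGroup F] [NormedSpace ℝ F]
    [FiniteDimensional ℝ F] (L : F →L[ℝ] (F →L[ℝ] ℝ)) (h : ∀ ξ, (∀ η, L ξ η = 0) → ξ = 0) :
    Function.Bijective L := by
  have hinj : Function.Injective L.toLinearMap := by
    rw [← LinearMap.ker_eq_bot, LinearMap.ker_eq_bot']
    intro ξ hξ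
    have hξ' : L ξ = 0 := hξ
    exact h ξ fun η => by rw [hξ']; rfl
  have hdim : finrank ℝ F = finrank ℝ (F →L[ℝ] ℝ) := by
    rw [← (LinearMap.toContinuousLinearMap : (F →ₗ[ℝ] ℝ) ≃ₗ[ℝ] F →L[ℝ] ℝ).finrank_eq]
    exact (Subspace.dual_finrank_eq (K := ℝ) (V := F)).symm
  exact ⟨hinj, (LinearMap.injective_iff_surjective_of_finrank_eq_finrank hdim).1 hinj⟩

end SphereCalculus

/-! ### Differentials of the generating function and the twist condition -/

section GeneratingFunction

variable {k : ℕ} {K : Set (EuclideanSpace ℝ (Fin (k + 1)))}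
  {n₁ n₂ : sphere (0 : EuclideanSpace ℝ (Fin (k + 1))) 1}

theorem sphere_sub_ne_zero (h : n₁ ≠ n₂) : (n₁ : EuclideanSpace ℝ (Fin (k + 1))) - n₂ ≠ 0 :=
  sub_ne_zero.2 fun h' => h (Subtype.ext h')

theorem norm_sphere_sub_sq (n₁ n₂ : sphere (0 : EuclideanSpace ℝ (Fin (k + 1))) 1) :
    ‖(n₁ : EuclideanSpace ℝ (Fin (k + 1))) - n₂‖ ^ 2 =
      2 * inner ℝ (n₁ : EuclideanSpace ℝ (Fin (k + 1)))
        ((n₁ : EuclideanSpace ℝ (Fin (k + 1))) - n₂) := by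
  rw [norm_sub_sq_real, inner_sub_right, real_inner_self_eq_norm_sq, sphere_norm_eq,
    sphere_norm_eq]
  ring

/-- This sign makes n₁ point outward at the bounce point; with n₁ and n₂ exchanged it gives the
transversality of n₂ as well. -/
theorem inner_sphere_sub_pos (h : n₁ ≠ n₂) :
    0 < inner ℝ (n₁ : EuclideanSpace ℝ (Fin (k + 1)))
      ((n₁ : EuclideanSpace ℝ (Fin (k + 1))) - n₂) := by
  have h1 := norm_sphere_sub_sq n₁ n₂
  have h2 := norm_pos_iff.2 (sphere_sub_ne_zero h)
  have h3 : 0 < ‖(n₁ : EuclideanSpace ℝ (Fin (k + 1))) - n₂‖ ^ 2 := by positivity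
  linarith

theorem inner_sphere_sub_ne_zero (h : n₁ ≠ n₂) :
    inner ℝ (n₂ : EuclideanSpace ℝ (Fin (k + 1)))
      ((n₁ : EuclideanSpace ℝ (Fin (k + 1))) - n₂) ≠ 0 := by
  rw [← neg_sub, inner_neg_right, neg_ne_zero]
  exact (inner_sphere_sub_pos h.symm).ne'

theorem genFun_eq_homogeneousSupportFun (n₁ n₂ : sphere (0 : EuclideanSpace ℝ (Fin (k + 1))) 1) :
    genFun K n₁ n₂ = homogeneousSupportFun K ((n₁ : EuclideanSpace ℝ (Fin (k + 1))) - n₂) := rfl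

theorem gaussInv_chordDir (n₁ n₂ : sphere (0 : EuclideanSpace ℝ (Fin (k + 1))) 1) :
    gaussInv K (chordDir n₁ n₂) = supportPoint K ((n₁ : EuclideanSpace ℝ (Fin (k + 1))) - n₂) :=
  rfl

namespace IsBilliardTable

theorem genD1_eq (hK : IsBilliardTable K) (h : n₁ ≠ n₂) :
    genD1 K n₁ n₂ = (innerSL ℝ (supportPoint K ((n₁ : EuclideanSpace ℝ (Fin (k + 1))) - n₂))).comp
      (sphereInclDeriv n₁) := by
  have h1 : HasFDerivAt (fun y => homogeneousSupportFun K (y - (n₂ : EuclideanSpace ℝ (Fin (k + 1)))))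
      (innerSL ℝ (supportPoint K ((n₁ : EuclideanSpace ℝ (Fin (k + 1))) - n₂)))
      (n₁ : EuclideanSpace ℝ (Fin (k + 1))) := by
    have := HasFDerivAt.comp (n₁ : EuclideanSpace ℝ (Fin (k + 1)))
      (f := fun y => id y - (n₂ : EuclideanSpace ℝ (Fin (k + 1))))
      (hK.hasFDerivAt_homogeneousSupportFun (sphere_sub_ne_zero h))
      ((hasFDerivAt_id (𝕜 := ℝ) (n₁ : EuclideanSpace ℝ (Fin (k + 1)))).sub_const
        (n₂ : EuclideanSpace ℝ (Fin (k + 1))))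
    simpa [Function.comp_def] using this
  exact (h1.hasMFDerivAt.comp n₁ (hasMFDerivAt_sphereIncl n₁)).mfderiv

theorem genD2_eq (hK : IsBilliardTable K) (h : n₁ ≠ n₂) :
    genD2 K n₁ n₂ = -(innerSL ℝ (supportPoint K ((n₁ : EuclideanSpace ℝ (Fin (k + 1))) - n₂))).comp
      (sphereInclDeriv n₂) := by
  have h1 : HasFDerivAt (fun y => homogeneousSupportFun K ((n₁ : EuclideanSpace ℝ (Fin (k + 1))) - y))
      (-(innerSL ℝ (supportPoint K ((n₁ : EuclideanSpace ℝ (Fin (k + 1))) - n₂))))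
      (n₂ : EuclideanSpace ℝ (Fin (k + 1))) := by
    have := HasFDerivAt.comp (n₂ : EuclideanSpace ℝ (Fin (k + 1)))
      (hK.hasFDerivAt_homogeneousSupportFun (sphere_sub_ne_zero h))
      ((hasFDerivAt_id (𝕜 := ℝ) (n₂ : EuclideanSpace ℝ (Fin (k + 1)))).const_sub
        (n₁ : EuclideanSpace ℝ (Fin (k + 1))))
    simpa [Function.comp_def] using this
  have h2 := (h1.hasMFDerivAt.comp n₂ (hasMFDerivAt_sphereIncl n₂)).mfderiv
  rw [← ContinuousLinearMap.neg_comp]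
  exact h2

/-- The differential of the support point pairs the tangent spaces at the ends of a chord of the
unit sphere nondegenerately. -/
theorem eq_zero_of_forall_inner_fderiv_eq_zero (hK : IsBilliardTable K)
    {v : EuclideanSpace ℝ (Fin (k + 1))} (hv : v ≠ 0)
    (h₁ : inner ℝ (n₁ : EuclideanSpace ℝ (Fin (k + 1))) v ≠ 0)
    (h₂ : inner ℝ (n₂ : EuclideanSpace ℝ (Fin (k + 1))) v ≠ 0) {ξ : EuclideanSpace ℝ (Fin k)}
    (h : ∀ η, inner ℝ (fderiv ℝ (supportPoint K) v (sphereInclDeriv n₁ ξ))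
      (sphereInclDeriv n₂ η) = 0) : ξ = 0 := by
  -- The image under dP is a multiple of n₂ and orthogonal to v; as ⟨n₂, v⟩ ≠ 0, it vanishes.
  have ha := eq_inner_smul_of_forall_inner_eq_zero h
  have hav := hK.inner_fderiv_supportPoint hv (sphereInclDeriv n₁ ξ)
  rw [ha, real_inner_smul_left] at hav
  rw [(mul_eq_zero.1 hav).resolve_right h₂, zero_smul] at ha
  -- Now the tangent vector at n₁ is a multiple of v; being orthogonal to n₁ while v is not, it is
  -- zero.
  obtain ⟨c, hc⟩ := hK.exists_eq_smul_of_fderiv_supportPoint_eq_zero hv ha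
  have hcn := inner_sphereInclDeriv n₁ ξ
  rw [hc, real_inner_smul_right] at hcn
  rw [(mul_eq_zero.1 hcn).resolve_right h₁, zero_smul] at hc
  exact sphereInclDeriv_injective n₁ (by rw [hc, map_zero])

theorem genD12_apply (hK : IsBilliardTable K) (h : n₁ ≠ n₂) (ξ η : EuclideanSpace ℝ (Fin k)) :
    (show EuclideanSpace ℝ (Fin k) →L[ℝ] (EuclideanSpace ℝ (Fin k) →L[ℝ] ℝ) from
      genD12 K n₁ n₂) ξ η =
      -inner ℝ (fderiv ℝ (supportPoint K) ((n₁ : EuclideanSpace ℝ (Fin (k + 1))) - n₂)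
        (sphereInclDeriv n₁ ξ)) (sphereInclDeriv n₂ η) := by
  -- The linear map x ↦ -⟨x, ·⟩ restricted to the tangent space at n₂. That space stays fixed, so
  -- only the support point has to be differentiated.
  let P : EuclideanSpace ℝ (Fin (k + 1)) →L[ℝ] (EuclideanSpace ℝ (Fin k) →L[ℝ] ℝ) :=
    -((ContinuousLinearMap.precomp ℝ (sphereInclDeriv n₂)).comp
      (rieszCovector (EuclideanSpace ℝ (Fin (k + 1)))))
  have h1 : HasFDerivAt (fun y => P (supportPoint K (y - (n₂ : EuclideanSpace ℝ (Fin (k + 1))))))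
      (P.comp (fderiv ℝ (supportPoint K) ((n₁ : EuclideanSpace ℝ (Fin (k + 1))) - n₂)))
      (n₁ : EuclideanSpace ℝ (Fin (k + 1))) := by
    have := P.hasFDerivAt.comp (n₁ : EuclideanSpace ℝ (Fin (k + 1)))
      (HasFDerivAt.comp (n₁ : EuclideanSpace ℝ (Fin (k + 1)))
      (f := fun y => id y - (n₂ : EuclideanSpace ℝ (Fin (k + 1))))
        (hK.hasFDerivAt_supportPoint (sphere_sub_ne_zero h))
        ((hasFDerivAt_id (𝕜 := ℝ) (n₁ : EuclideanSpace ℝ (Fin (k + 1)))).sub_const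
        (n₂ : EuclideanSpace ℝ (Fin (k + 1)))))
    simpa [Function.comp_def] using this
  have h2 := h1.hasMFDerivAt.comp n₁ (hasMFDerivAt_sphereIncl n₁)
  have h3 : (fun n => (show EuclideanSpace ℝ (Fin k) →L[ℝ] ℝ from genD2 K n n₂)) =ᶠ[nhds n₁]
      fun n : sphere (0 : EuclideanSpace ℝ (Fin (k + 1))) 1 =>
        P (supportPoint K ((n : EuclideanSpace ℝ (Fin (k + 1))) - n₂)) := by
    filter_upwards [isOpen_ne.mem_nhds h] with n hn
    exact (hK.genD2_eq hn).trans (by rfl)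
  have h4 := (h2.congr_of_eventuallyEq h3).mfderiv
  have h5 : (show EuclideanSpace ℝ (Fin k) →L[ℝ] (EuclideanSpace ℝ (Fin k) →L[ℝ] ℝ) from
      genD12 K n₁ n₂) = (P.comp (fderiv ℝ (supportPoint K)
        ((n₁ : EuclideanSpace ℝ (Fin (k + 1))) - n₂))).comp (sphereInclDeriv n₁) := h4
  rw [h5]
  simp [P]

theorem genD21_apply (hK : IsBilliardTable K) (h : n₁ ≠ n₂) (η ξ : EuclideanSpace ℝ (Fin k)) :
    (show EuclideanSpace ℝ (Fin k) →L[ℝ] (EuclideanSpace ℝ (Fin k) →L[ℝ] ℝ) from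
      genD21 K n₁ n₂) η ξ =
      -inner ℝ (fderiv ℝ (supportPoint K) ((n₁ : EuclideanSpace ℝ (Fin (k + 1))) - n₂)
        (sphereInclDeriv n₂ η)) (sphereInclDeriv n₁ ξ) := by
  let P : EuclideanSpace ℝ (Fin (k + 1)) →L[ℝ] (EuclideanSpace ℝ (Fin k) →L[ℝ] ℝ) :=
    (ContinuousLinearMap.precomp ℝ (sphereInclDeriv n₁)).comp
      (rieszCovector (EuclideanSpace ℝ (Fin (k + 1))))
  have h1 : HasFDerivAt (fun y => P (supportPoint K ((n₁ : EuclideanSpace ℝ (Fin (k + 1))) - y)))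
      (-(P.comp (fderiv ℝ (supportPoint K) ((n₁ : EuclideanSpace ℝ (Fin (k + 1))) - n₂))))
      (n₂ : EuclideanSpace ℝ (Fin (k + 1))) := by
    have := P.hasFDerivAt.comp (n₂ : EuclideanSpace ℝ (Fin (k + 1)))
      (HasFDerivAt.comp (n₂ : EuclideanSpace ℝ (Fin (k + 1)))
        (hK.hasFDerivAt_supportPoint (sphere_sub_ne_zero h))
        ((hasFDerivAt_id (𝕜 := ℝ) (n₂ : EuclideanSpace ℝ (Fin (k + 1)))).const_sub
          (n₁ : EuclideanSpace ℝ (Fin (k + 1)))))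
    simpa [Function.comp_def] using this
  have h2 := h1.hasMFDerivAt.comp n₂ (hasMFDerivAt_sphereIncl n₂)
  have h3 : (fun n => (show EuclideanSpace ℝ (Fin k) →L[ℝ] ℝ from genD1 K n₁ n)) =ᶠ[nhds n₂]
      fun n : sphere (0 : EuclideanSpace ℝ (Fin (k + 1))) 1 =>
        P (supportPoint K ((n₁ : EuclideanSpace ℝ (Fin (k + 1))) - n)) := by
    filter_upwards [isOpen_ne.mem_nhds h.symm] with n hn
    exact (hK.genD1_eq (Ne.symm hn)).trans (by rfl)
  have h4 := (h2.congr_of_eventuallyEq h3).mfderiv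
  have h5 : (show EuclideanSpace ℝ (Fin k) →L[ℝ] (EuclideanSpace ℝ (Fin k) →L[ℝ] ℝ) from
      genD21 K n₁ n₂) = (-(P.comp (fderiv ℝ (supportPoint K)
        ((n₁ : EuclideanSpace ℝ (Fin (k + 1))) - n₂)))).comp (sphereInclDeriv n₂) := h4
  rw [h5]
  simp [P]

theorem genD12_bijective (hK : IsBilliardTable K) (h : n₁ ≠ n₂) :
    Function.Bijective (genD12 K n₁ n₂) :=
  bijective_of_forall_eq_zero (F := EuclideanSpace ℝ (Fin k)) (genD12 K n₁ n₂) fun ξ hξ =>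
    hK.eq_zero_of_forall_inner_fderiv_eq_zero (sphere_sub_ne_zero h) (inner_sphere_sub_pos h).ne'
      (inner_sphere_sub_ne_zero h) fun η => by
        rw [← neg_eq_zero, ← hK.genD12_apply h]
        exact hξ η

theorem genD21_bijective (hK : IsBilliardTable K) (h : n₁ ≠ n₂) :
    Function.Bijective (genD21 K n₁ n₂) :=
  bijective_of_forall_eq_zero (F := EuclideanSpace ℝ (Fin k)) (genD21 K n₁ n₂) fun ξ hξ =>
    hK.eq_zero_of_forall_inner_fderiv_eq_zero (sphere_sub_ne_zero h)
      (inner_sphere_sub_ne_zero h) (inner_sphere_sub_pos h).ne' fun η => by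
        rw [← neg_eq_zero, ← hK.genD21_apply h]
        exact hξ η

theorem contMDiffOn_genFun (hK : IsBilliardTable K) :
    ContMDiffOn ((𝓡 k).prod (𝓡 k)) 𝓘(ℝ, ℝ) ∞
      (fun p : sphere (0 : EuclideanSpace ℝ (Fin (k + 1))) 1 ×
          sphere (0 : EuclideanSpace ℝ (Fin (k + 1))) 1 => genFun K p.1 p.2)
      {p | p.1 ≠ p.2} := by
  have := fact_finrank_euclideanSpace k
  intro p hp
  have h1 : ContMDiffAt ((𝓡 k).prod (𝓡 k)) 𝓘(ℝ, EuclideanSpace ℝ (Fin (k + 1))) ∞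
      (fun p : sphere (0 : EuclideanSpace ℝ (Fin (k + 1))) 1 ×
          sphere (0 : EuclideanSpace ℝ (Fin (k + 1))) 1 =>
        (p.1 : EuclideanSpace ℝ (Fin (k + 1))) - p.2) p :=
    ((contMDiff_coe_sphere.comp contMDiff_fst).sub
      (contMDiff_coe_sphere.comp contMDiff_snd)).contMDiffAt
  exact (ContMDiffAt.comp p
    (hK.contDiffAt_homogeneousSupportFun (sphere_sub_ne_zero hp)).contMDiffAt h1).contMDiffWithinAt

end IsBilliardTable

end GeneratingFunction

/-! ### Exit points and the reflection law -/

section BilliardMap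

variable {k : ℕ} {K : Set (EuclideanSpace ℝ (Fin (k + 1)))} {l : OrientedLine k}

theorem OrientedLine.inner_point_dir (l : OrientedLine k) (t : ℝ) :
    inner ℝ (l.point t) (l.dir : EuclideanSpace ℝ (Fin (k + 1))) = t := by
  rw [OrientedLine.point, inner_add_left, l.foot_perp_dir, real_inner_smul_left,
    real_inner_self_eq_norm_sq, sphere_norm_eq]
  ring

theorem OrientedLine.point_add (l : OrientedLine k) (s t : ℝ) :
    l.point (s + t) = l.point s + t • (l.dir : EuclideanSpace ℝ (Fin (k + 1))) := by
  simp [OrientedLine.point, add_smul, add_assoc]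

theorem coe_reflectedDir (hG : ‖gaussMap K (exitPoint K l)‖ = 1) :
    (reflectedDir K l : EuclideanSpace ℝ (Fin (k + 1))) =
      l.dir - (2 * inner ℝ (gaussMap K (exitPoint K l))
        (l.dir : EuclideanSpace ℝ (Fin (k + 1)))) • gaussMap K (exitPoint K l) := by
  change (Submodule.span ℝ {gaussMap K (exitPoint K l)})ᗮ.reflection
    (l.dir : EuclideanSpace ℝ (Fin (k + 1))) = _
  rw [Submodule.reflection_orthogonal_apply, Submodule.reflection_singleton_apply, hG]
  simp only [RCLike.ofReal_real_eq_id, id_eq, one_pow, div_one, two_smul, two_mul, add_smul]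
  abel

namespace IsBilliardTable

/-- Ensures that the supremum in `exitPoint` is attained. The times are bounded because t = ⟨m + tn,
n⟩ is at most the norm of the point. -/
theorem isGreatest_exitTime (hK : IsBilliardTable K) {t : ℝ} (ht : l.point t ∈ K) :
    IsGreatest {t : ℝ | l.point t ∈ K} (sSup {t : ℝ | l.point t ∈ K}) := by
  have hcont : Continuous l.point := by
    unfold OrientedLine.point
    fun_prop
  have hclosed : IsClosed {t : ℝ | l.point t ∈ K} := hK.isClosed.preimage hcont
  have hbdd : BddAbove {t : ℝ | l.point t ∈ K} := by
    obtain ⟨C, hC⟩ := hK.compact.isBounded.exists_norm_le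
    refine ⟨C, fun s hs => ?_⟩
    have h1 := real_inner_le_norm (l.point s) (l.dir : EuclideanSpace ℝ (Fin (k + 1)))
    rw [l.inner_point_dir, sphere_norm_eq, mul_one] at h1
    exact h1.trans (hC _ hs)
  exact ⟨hclosed.csSup_mem ⟨t, ht⟩ hbdd, fun s hs => le_csSup hbdd hs⟩

theorem exitPoint_mem_frontier (hK : IsBilliardTable K) {t : ℝ} (ht : l.point t ∈ K) :
    exitPoint K l ∈ frontier K := by
  have hg := hK.isGreatest_exitTime ht
  refine ⟨subset_closure hg.1, fun hint => ?_⟩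
  set T := sSup {t : ℝ | l.point t ∈ K}
  have hcont : ContinuousAt l.point T := by
    unfold OrientedLine.point
    fun_prop
  have hev : ∀ᶠ s in nhdsWithin T (Set.Ioi T), l.point s ∈ K :=
    nhdsWithin_le_nhds (hcont.eventually_mem (mem_interior_iff_mem_nhds.1 hint))
  obtain ⟨s, hsK, hs⟩ := (hev.and self_mem_nhdsWithin).exists
  exact absurd (hg.2 hsK) (not_le.2 hs)

/-- Otherwise the direction would point into the body and the line would stay in K beyond its last
time. -/
theorem inner_gaussMap_exitPoint_nonneg (hK : IsBilliardTable K) {t : ℝ} (ht : l.point t ∈ K) :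
    0 ≤ inner ℝ (gaussMap K (exitPoint K l)) (l.dir : EuclideanSpace ℝ (Fin (k + 1))) := by
  by_contra! hneg
  have hg := hK.isGreatest_exitTime ht
  have hf := hK.exitPoint_mem_frontier ht
  obtain ⟨-, U, f, h, hx, hν⟩ := hK.isOuterUnitNormal_gaussMap hf
  have hw : fderiv ℝ f (exitPoint K l) (l.dir : EuclideanSpace ℝ (Fin (k + 1))) < 0 := by
    rw [hν, real_inner_smul_left, inner_gradient] at hneg
    by_contra! hcon
    exact absurd hneg (not_lt.2 (mul_nonneg (by positivity) hcon))
  obtain ⟨s, hsK, hs⟩ := ((h.eventually_add_smul_mem hx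
    (h.apply_frontier hK.isClosed hx hf).le hw).and self_mem_nhdsWithin).exists
  rw [exitPoint, ← l.point_add] at hsK
  have h1 := hg.2 hsK
  have hs0 : 0 < s := hs
  linarith

/-- A line crossing the supporting hyperplane outward never returns to K. -/
theorem exitPoint_eq (hK : IsBilliardTable K) {t : ℝ} (ht : l.point t ∈ frontier K)
    (hpos : 0 < inner ℝ (gaussMap K (l.point t)) (l.dir : EuclideanSpace ℝ (Fin (k + 1)))) :
    exitPoint K l = l.point t := by
  rw [exitPoint]
  congr 1
  refine IsGreatest.csSup_eq ⟨hK.isClosed.frontier_subset ht, fun s hs => ?_⟩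
  have h1 := hK.inner_gaussMap_le ht hs
  rw [show s = t + (s - t) by ring, l.point_add, inner_add_right, real_inner_smul_right] at h1
  by_contra! hlt
  have := mul_pos (sub_pos.2 hlt) hpos
  linarith

/-- An unchanged direction is tangent at the exit point, so the line lies in the supporting
hyperplane there, which misses the interior. -/
theorem dir_ne_billiardMap_dir (hK : IsBilliardTable K) (hl : ∃ t : ℝ, l.point t ∈ interior K) :
    l.dir ≠ (billiardMap K l).dir := by
  obtain ⟨t, ht⟩ := hl
  have htK := interior_subset ht
  have hf := hK.exitPoint_mem_frontier htK
  have hG := hK.norm_gaussMap hf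
  intro heq
  have h1 : (l.dir : EuclideanSpace ℝ (Fin (k + 1))) = reflectedDir K l := congrArg Subtype.val heq
  rw [coe_reflectedDir hG, eq_comm, sub_eq_self, smul_eq_zero] at h1
  have h2 : inner ℝ (gaussMap K (exitPoint K l)) (l.dir : EuclideanSpace ℝ (Fin (k + 1))) = 0 := by
    rcases h1 with h1 | h1
    · linarith
    · rw [h1, norm_zero] at hG
      exact absurd hG zero_ne_one
  have h3 := hK.inner_gaussMap_lt hf ht
  have h4 : exitPoint K l = l.point t + (sSup {t : ℝ | l.point t ∈ K} - t) •
      (l.dir : EuclideanSpace ℝ (Fin (k + 1))) := by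
    rw [← l.point_add, add_sub_cancel, exitPoint]
  -- Only the occurrence outside `gaussMap` is to be expanded.
  nth_rewrite 3 [h4] at h3
  rw [inner_add_right, real_inner_smul_right, h2, mul_zero, add_zero] at h3
  exact lt_irrefl _ h3

/-- The reflection law: the billiard map takes `l₁` to `l₂` exactly when both lines pass through the
boundary point whose outer normal has the direction of `l₁.dir - l₂.dir`. -/
theorem billiardMap_eq_iff (hK : IsBilliardTable K) {l₁ l₂ : OrientedLine k}
    (hne : l₁.dir ≠ l₂.dir) {P : EuclideanSpace ℝ (Fin (k + 1))}
    (hP : P = supportPoint K ((l₁.dir : EuclideanSpace ℝ (Fin (k + 1))) - l₂.dir)) :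
    (l₁ ∈ phaseSpace K ∧ billiardMap K l₁ = l₂) ↔
      (l₁.foot = P - inner ℝ P (l₁.dir : EuclideanSpace ℝ (Fin (k + 1))) •
          (l₁.dir : EuclideanSpace ℝ (Fin (k + 1))) ∧
        l₂.foot = P - inner ℝ P (l₂.dir : EuclideanSpace ℝ (Fin (k + 1))) •
          (l₂.dir : EuclideanSpace ℝ (Fin (k + 1)))) := by
  have hv := sphere_sub_ne_zero hne
  have hvpos := norm_pos_iff.2 hv
  constructor
  · rintro ⟨⟨t, ht⟩, rfl⟩
    have htK := hK.isClosed.frontier_subset ht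
    have hf := hK.exitPoint_mem_frontier htK
    have hG := hK.norm_gaussMap hf
    set ν := gaussMap K (exitPoint K l₁) with hν
    set c := inner ℝ ν (l₁.dir : EuclideanSpace ℝ (Fin (k + 1))) with hc
    have hdir : ((billiardMap K l₁).dir : EuclideanSpace ℝ (Fin (k + 1))) =
        l₁.dir - (2 * c) • ν := coe_reflectedDir hG
    have hsub : (l₁.dir : EuclideanSpace ℝ (Fin (k + 1))) - (billiardMap K l₁).dir =
        (2 * c) • ν := by rw [hdir, sub_sub_cancel]
    have hc0 : 0 ≤ c := hK.inner_gaussMap_exitPoint_nonneg htK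
    have hcpos : 0 < 2 * c := by
      refine lt_of_le_of_ne (by linarith) fun h0 => hv ?_
      rw [hsub, ← h0, zero_smul]
    -- The difference of directions is 2cν with c > 0, so it normalizes to ν, the normal at the exit
    -- point; injectivity of the Gauss map identifies the points.
    have hPe : P = exitPoint K l₁ := by
      rw [hP, supportPoint, hsub, norm_smul, hG, mul_one, Real.norm_of_nonneg hcpos.le,
        inv_smul_smul₀ hcpos.ne']
      exact hK.gaussInv_eq (hK.isOuterUnitNormal_gaussMap hf)
    rw [hPe]
    refine ⟨?_, rfl⟩
    rw [exitPoint, l₁.inner_point_dir, OrientedLine.point, add_sub_cancel_right]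
  · rintro ⟨h1, h2⟩
    have hn := hK.isOuterUnitNormal_supportPoint hv
    rw [← hP] at hn
    have hpt : l₁.point (inner ℝ P (l₁.dir : EuclideanSpace ℝ (Fin (k + 1)))) = P := by
      rw [OrientedLine.point, h1, sub_add_cancel]
    have hG := hK.gaussMap_eq hn
    have hPf := hn.1
    have hexit : exitPoint K l₁ = P := by
      rw [hK.exitPoint_eq (by rwa [hpt]), hpt]
      rw [hpt, hG, real_inner_smul_left, real_inner_comm]
      exact mul_pos (inv_pos.2 hvpos) (inner_sphere_sub_pos hne)
    have hdir : reflectedDir K l₁ = l₂.dir := by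
      apply Subtype.ext
      rw [coe_reflectedDir (by rw [hexit]; exact hK.norm_gaussMap hPf), hexit, hG,
        real_inner_smul_left, real_inner_comm, smul_smul]
      -- For v = n₁ - n₂ the reflection subtracts (2⟨n₁, v⟩/|v|²) v from n₁, and the coefficient is
      -- 1 because both directions are unit vectors.
      have hcoef : 2 * (‖(l₁.dir : EuclideanSpace ℝ (Fin (k + 1))) - l₂.dir‖⁻¹ *
          inner ℝ (l₁.dir : EuclideanSpace ℝ (Fin (k + 1)))
            ((l₁.dir : EuclideanSpace ℝ (Fin (k + 1))) - l₂.dir)) *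
          ‖(l₁.dir : EuclideanSpace ℝ (Fin (k + 1))) - l₂.dir‖⁻¹ = 1 := by
        have := norm_sphere_sub_sq l₁.dir l₂.dir
        field_simp
        linarith
      rw [hcoef, one_smul, sub_sub_cancel]
    refine ⟨⟨_, by rw [hpt]; exact hPf⟩, OrientedLine.ext hdir ?_⟩
    rw [billiardMap, OrientedLine.through, hexit, hdir, h2]

/-- Equality of covectors with those of the support point is equality of feet with those of the
lines through it, so the reflection law applies. -/
theorem billiardMap_eq_iff_covector (hK : IsBilliardTable K) {l₁ l₂ : OrientedLine k}
    (hne : l₁.dir ≠ l₂.dir) :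
    (l₁ ∈ phaseSpace K ∧ billiardMap K l₁ = l₂) ↔
      (l₁.covector = genD1 K l₁.dir l₂.dir ∧ l₂.covector = -genD2 K l₁.dir l₂.dir) := by
  have h₂ : -genD2 K l₁.dir l₂.dir =
      (innerSL ℝ (supportPoint K ((l₁.dir : EuclideanSpace ℝ (Fin (k + 1))) - l₂.dir))).comp
        (sphereInclDeriv l₂.dir) :=
    (congrArg Neg.neg (hK.genD2_eq hne)).trans (neg_neg _)
  rw [hK.billiardMap_eq_iff hne rfl, hK.genD1_eq hne, h₂]
  exact and_congr (innerSL_comp_sphereInclDeriv_eq_iff l₁.foot_perp_dir).symm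
    (innerSL_comp_sphereInclDeriv_eq_iff l₂.foot_perp_dir).symm

end IsBilliardTable

end BilliardMap

theorem theorem5p2 (k : ℕ) (hk : 1 ≤ k) (K : Set (EuclideanSpace ℝ (Fin (k + 1))))
    (hK : IsBilliardTable K) :
    -- the Gauss map is a bijection of the hypersurface onto the unit sphere,
    -- and it expresses the support function
    Set.BijOn (gaussMap K) (frontier K) (sphere 0 1) ∧
    (∀ n ∈ sphere (0 : EuclideanSpace ℝ (Fin (k + 1))) 1,
      supportFun K n = inner ℝ (gaussInv K n) n) ∧
    -- the generating function: its two expressions, and its smoothness off the diagonal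
    (∀ n₁ n₂ : sphere (0 : EuclideanSpace ℝ (Fin (k + 1))) 1, n₁ ≠ n₂ →
      genFun K n₁ n₂ = inner ℝ (gaussInv K (chordDir n₁ n₂))
        ((n₁ : EuclideanSpace ℝ (Fin (k + 1))) - n₂)) ∧
    ContMDiffOn ((𝓡 k).prod (𝓡 k)) 𝓘(ℝ, ℝ) ∞
      (fun p : sphere (0 : EuclideanSpace ℝ (Fin (k + 1))) 1 ×
          sphere (0 : EuclideanSpace ℝ (Fin (k + 1))) 1 => genFun K p.1 p.2)
      {p | p.1 ≠ p.2} ∧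
    -- a line that enters the interior of the table is mapped to a line of another direction
    (∀ l : OrientedLine k, (∃ t : ℝ, l.point t ∈ interior K) →
      l.dir ≠ (billiardMap K l).dir) ∧
    -- the billiard map is given by the generating function
    (∀ l₁ l₂ : OrientedLine k, l₁.dir ≠ l₂.dir →
      ((l₁ ∈ phaseSpace K ∧ billiardMap K l₁ = l₂) ↔
        (l₁.covector = genD1 K l₁.dir l₂.dir ∧ l₂.covector = -genD2 K l₁.dir l₂.dir))) ∧
    -- the twist condition
    (∀ n₁ n₂ : sphere (0 : EuclideanSpace ℝ (Fin (k + 1))) 1, n₁ ≠ n₂ →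
      Function.Bijective (genD12 K n₁ n₂) ∧ Function.Bijective (genD21 K n₁ n₂)) := by
  exact ⟨hK.bijOn_gaussMap, fun n hn => hK.supportFun_eq (by simpa using hn),
    fun n₁ n₂ h => by
      rw [genFun_eq_homogeneousSupportFun, gaussInv_chordDir,
        hK.homogeneousSupportFun_eq (sphere_sub_ne_zero h)],
    hK.contMDiffOn_genFun, fun l hl => hK.dir_ne_billiardMap_dir hl,
    fun l₁ l₂ h => hK.billiardMap_eq_iff_covector h,
    fun n₁ n₂ h => ⟨hK.genD12_bijective h, hK.genD21_bijective h⟩⟩
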